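/- Let $\mathbb{K}$ be a field of characteristic zero. Permutations of size $n\ge 0$ are seen as words that are rearrangements of $12\cdots n$, and $\mathfrak{S}$ is the set of all permutations of all sizes. Let $\mathbf{FQSym}$ be the $\mathbb{K}$-vector space with basis $\{\mathbf{F}_\sigma\}_{\sigma\in\mathfrak{S}}$, with product and coproduct $$\mathbf{F}_\sigma\cdot\mathbf{F}_\nu=\sum_{\pi}\mathbf{F}_\pi,\qquad \Delta(\mathbf{F}_\sigma)=\sum_{\sigma=uv}\mathbf{F}_{\operatorname{std}(u)}\otimes\mathbf{F}_{\operatorname{std}(v)},$$ where $\pi$ runs over the terms of the shuffle of $\sigma$ with the word obtained from $\nu$ by adding $|\sigma|$ to each letter, and where $\operatorname{std}(u)$ is the permutation of size $|u|$ having the same inversions as $u$. The leaves of a binary tree (a leaf, or a node with a left and a right subtree) are left- or right-oriented; the canopy of a binary tree is the word recording, from left to right, the orientations of all its leaves except the first and the last. A pair of twin binary trees is a pair $J=(T_L,T_R)$ of binary trees with the same number of nodes whose canopies differ in every position. The $\mathsf{P}$-symbol $\mathsf{P}(\sigma)$ of a permutation $\sigma$ is the pair formed by the shape of the binary search tree obtained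 by leaf-inserting the letters of $\sigma$ from left to right, and the shape of the one obtained by leaf-inserting them from right to left. For a pair of twin binary trees $J$, let $$\mathbf{P}_J=\sum_{\sigma\in\mathfrak{S},\ \mathsf{P}(\sigma)=J}\mathbf{F}_\sigma,$$ and let $\mathbf{Baxter}$ be the subspace of $\mathbf{FQSym}$ spanned by the $\mathbf{P}_J$. **Proposition.** The product and the coproduct of $\mathbf{FQSym}$ restrict to maps $\mathbf{Baxter}\otimes\mathbf{Baxter}\to\mathbf{Baxter}$ and $\mathbf{Baxter}\to\mathbf{Baxter}\otimes\mathbf{Baxter}$. The family $\{\mathbf{P}_J\}$, where $J$ runs over all pairs of twin binary trees, is a basis of $\mathbf{Baxter}$, and it is both a boolean algebra basis and a boolean coalgebra basis: for all $J_0,J_1$, every coefficient of $\mathbf{P}_{J_0}\cdot\mathbf{P}_{J_1}$ on the basis $\{\mathbf{P}_J\}$ is $0$ or $1$, and for every $J$, every coefficient of $\Delta(\mathbf{P}_J)$ on the basis $\{\mathbf{P}_{J'}\otimes\mathbf{P}_{J''}\}$ of $\mathbf{Baxter}\otimes\mathbf{Baxter}$ is $0$ or $1$. -/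

import Mathlib

open scoped TensorProduct

namespace BaxterHopf

/-! ### Words and permutations

The alphabet is `{1 < 2 < 3 < ⋯}`, so words are lists of natural numbers. -/

/-- A word is a permutation (of size its length `n`) if it is a rearrangement of `1 2 ⋯ n`. -/
def IsPermutation (u : List ℕ) : Prop :=
  u.Perm (List.range' 1 u.length)

instance (u : List ℕ) : Decidable (IsPermutation u) :=
  inferInstanceAs (Decidable (u.Perm (List.range' 1 u.length)))

/-- The set of all permutations of all sizes `n ≥ 0`, seen as words. -/
abbrev Permutation : Type :=
  {u : List ℕ // IsPermutation u}

/-- The finite set of the permutations of size `n`. -/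
def permutationsOfSize (n : ℕ) : Finset Permutation :=
  (List.range' 1 n).permutations.toFinset.subtype IsPermutation

theorem mem_permutationsOfSize {n : ℕ} {σ : Permutation} :
    σ ∈ permutationsOfSize n ↔ σ.1.length = n := by
  simp only [permutationsOfSize, Finset.mem_subtype, List.mem_toFinset, List.mem_permutations]
  constructor
  · intro h
    simpa using h.length_eq
  · rintro rfl
    exact σ.2

/-- The shuffle product of two words, as the list (with multiplicities) of its terms. -/
def shuffle : List ℕ → List ℕ → List (List ℕ)
  | [], v => [v]
  | a :: u, [] => [a :: u]
  | a :: u, b :: v =>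
      (shuffle u (b :: v)).map (List.cons a) ++ (shuffle (a :: u) v).map (List.cons b)
  termination_by u v => u.length + v.length

/-- The shifted shuffle product: the letters of the second word are first incremented by the
length of the first one. -/
def shiftedShuffle (u v : List ℕ) : List (List ℕ) :=
  shuffle u (v.map (· + u.length))

theorem perm_of_mem_shuffle (u v : List ℕ) : ∀ w ∈ shuffle u v, w.Perm (u ++ v) := by
  induction u, v using shuffle.induct with
  | case1 v => intro w hw; simp [shuffle] at hw; simp [hw]
  | case2 a u => intro w hw; simp [shuffle] at hw; simp [hw]
  | case3 a u b v ih₁ ih₂ =>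
    intro w hw
    simp only [shuffle, List.mem_append, List.mem_map] at hw
    rcases hw with ⟨x, hx, rfl⟩ | ⟨x, hx, rfl⟩
    · exact (ih₁ x hx).cons a
    · exact ((ih₂ x hx).cons b).trans List.perm_middle.symm

theorem isPermutation_of_mem_shiftedShuffle (σ ν : Permutation) :
    ∀ w ∈ shiftedShuffle σ.1 ν.1, IsPermutation w := by
  intro w hw
  have h := perm_of_mem_shuffle _ _ w hw
  have hl : w.length = σ.1.length + ν.1.length := by simpa using h.length_eq
  have hν : (ν.1.map (· + σ.1.length)).Perm (List.range' (1 + σ.1.length) ν.1.length) := by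
    have := ν.2.map (· + σ.1.length)
    have e : (List.range' 1 ν.1.length).map (· + σ.1.length)
        = List.range' (1 + σ.1.length) ν.1.length := by
      rw [Nat.add_comm 1, ← List.map_add_range']
      exact List.map_congr_left fun x _ => Nat.add_comm _ _
    rwa [e] at this
  unfold IsPermutation
  rw [hl, ← List.range'_append_1]
  exact h.trans (σ.2.append hν)

/-- The letters of the standardized word of `u`: the `i`-th letter is the rank of the `i`-th letter
of `u`, equal letters being ranked from left to right. -/
def stdWord (u : List ℕ) : List ℕ :=
  (List.finRange u.length).map fun i =>
    (Finset.univ.filter fun j : Fin u.length => u[j] < u[i] ∨ (u[j] = u[i] ∧ j ≤ i)).card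

theorem isPermutation_stdWord (u : List ℕ) : IsPermutation (stdWord u) := by
  have hlen : (stdWord u).length = u.length := by simp [stdWord]
  have key : ∀ i k : Fin u.length, (u[i] < u[k] ∨ (u[i] = u[k] ∧ i < k)) →
      (Finset.univ.filter fun j : Fin u.length => u[j] < u[i] ∨ (u[j] = u[i] ∧ j ≤ i)).card <
      (Finset.univ.filter fun j : Fin u.length => u[j] < u[k] ∨ (u[j] = u[k] ∧ j ≤ k)).card := by
    intro i k hik
    apply Finset.card_lt_card
    rw [Finset.ssubset_iff_of_subset]
    · refine ⟨k, by simp, ?_⟩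
      simp only [Finset.mem_filter, Finset.mem_univ, true_and]
      omega
    · intro j hj
      simp only [Finset.mem_filter, Finset.mem_univ, true_and] at hj ⊢
      omega
  have hnd : (stdWord u).Nodup := by
    refine List.Nodup.map ?_ (List.nodup_finRange _)
    intro i k h
    by_contra hne
    rcases lt_trichotomy u[i] u[k] with h' | h' | h'
    · exact absurd h (key i k (Or.inl h')).ne
    · rcases lt_or_gt_of_ne hne with h'' | h''
      · exact absurd h (key i k (Or.inr ⟨h', h''⟩)).ne
      · exact absurd h (key k i (Or.inr ⟨h'.symm, h''⟩)).ne'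
    · exact absurd h (key k i (Or.inl h')).ne'
  have hsub : stdWord u ⊆ List.range' 1 (stdWord u).length := by
    intro x hx
    rw [hlen]
    simp only [stdWord, List.mem_map, List.mem_finRange, true_and] at hx
    obtain ⟨i, rfl⟩ := hx
    rw [List.mem_range'_1]
    constructor
    · exact Finset.card_pos.mpr ⟨i, by simp⟩
    · have := Finset.card_le_univ
        (Finset.univ.filter fun j : Fin u.length => u[j] < u[i] ∨ (u[j] = u[i] ∧ j ≤ i))
      rw [Fintype.card_fin] at this
      omega
  exact (List.subperm_of_subset hnd hsub).perm_of_length_le (by simp)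

/-- The standardization of a word. -/
def std (u : List ℕ) : Permutation :=
  ⟨stdWord u, isPermutation_stdWord u⟩

/-! ### Pairs of twin binary trees -/

/-- The orientations of the leaves of a binary tree from left to right (`true` for left-oriented,
`false` for right-oriented), where `b` is the orientation to give to the tree if it is a leaf. -/
def leafOrientations {α : Type} : Bool → BinaryTree α → List Bool
  | b, .nil => [b]
  | _, .node _ l r => leafOrientations true l ++ leafOrientations false r

/-- The canopy of a binary tree: the orientations of all its leaves except the first and the last
one, where `true` stands for `1` (left-oriented) and `false` for `0` (right-oriented). -/
def canopy {α : Type} (T : BinaryTree α) : List Bool :=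
  (leafOrientations true T).tail.dropLast

/-- Pairs of twin binary trees: pairs of unlabeled binary trees with the same number of nodes and
with complementary canopies. -/
abbrev TwinPair : Type :=
  {J : BinaryTree Unit × BinaryTree Unit //
    J.1.numNodes = J.2.numNodes ∧ canopy J.1 = (canopy J.2).map not}

/-- Leaf insertion of a letter in a left binary search tree. -/
def leftInsert (a : ℕ) : BinaryTree ℕ → BinaryTree ℕ
  | .nil => .node a .nil .nil
  | .node b l r => if a < b then .node b (leftInsert a l) r else .node b l (leftInsert a r)

/-- Leaf insertion of a letter in a right binary search tree. -/
def rightInsert (a : ℕ) : BinaryTree ℕ → BinaryTree ℕ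
  | .nil => .node a .nil .nil
  | .node b l r => if a ≤ b then .node b (rightInsert a l) r else .node b l (rightInsert a r)

/-- The Baxter P-symbol of a word: the left (resp. right) binary search tree obtained by leaf
inserting its letters from left to right (resp. from right to left). -/
def pSymbol (u : List ℕ) : BinaryTree ℕ × BinaryTree ℕ :=
  (u.foldl (fun T a => leftInsert a T) .nil, u.foldr rightInsert .nil)

/-- The unlabeled tree underlying a labeled tree. -/
def shape (T : BinaryTree ℕ) : BinaryTree Unit :=
  T.map fun _ => ()

/-- The P-symbol of a permutation, regarded as a pair of unlabeled binary trees. -/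
def pShape (σ : Permutation) : BinaryTree Unit × BinaryTree Unit :=
  (shape (pSymbol σ.1).1, shape (pSymbol σ.1).2)

/-! ### Free quasi-symmetric functions -/

section Algebra

variable (K : Type*) [Field K]

/-- The vector space of free quasi-symmetric functions, with basis indexed by permutations. -/
abbrev FQSym : Type _ :=
  Permutation →₀ K

/-- The fundamental basis of `FQSym`. -/
noncomputable def F (σ : Permutation) : FQSym K :=
  Finsupp.single σ 1

/-- The product of `FQSym`: the bilinear map such that `F σ * F ν` is the sum of the `F π` over the
terms `π` of the shifted shuffle of `σ` and `ν`. -/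
noncomputable def FQSym.mul : FQSym K →ₗ[K] FQSym K →ₗ[K] FQSym K :=
  Finsupp.linearCombination K fun σ : Permutation =>
    Finsupp.linearCombination K fun ν : Permutation =>
      ((shiftedShuffle σ.1 ν.1).pmap (fun w hw => F K ⟨w, hw⟩)
        (isPermutation_of_mem_shiftedShuffle σ ν)).sum

/-- The coproduct of `FQSym`: the linear map sending `F σ` to the sum of `F (std u) ⊗ F (std v)`
over all the factorizations `σ = u v`, that is `u` is the prefix of some length `i ≤ |σ|`. -/
noncomputable def FQSym.comul : FQSym K →ₗ[K] FQSym K ⊗[K] FQSym K :=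
  Finsupp.linearCombination K fun σ : Permutation =>
    ∑ i ∈ Finset.range (σ.1.length + 1),
      F K (std (σ.1.take i)) ⊗ₜ[K] F K (std (σ.1.drop i))

/-- The element `P_J`: the sum of the `F σ` over the permutations `σ` whose P-symbol is `J`.
(Such a permutation has as many letters as `J` has nodes in each tree.) -/
noncomputable def P (J : TwinPair) : FQSym K :=
  ∑ σ ∈ permutationsOfSize J.1.1.numNodes with pShape σ = J.1, F K σ

/-- The underlying space of the Hopf algebra `Baxter`: the subspace of `FQSym` spanned by the
family `P`. -/
noncomputable def Baxter : Submodule K (FQSym K) :=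
  Submodule.span K (Set.range (P K))

variable {K}

/-- A basis of an algebra with product `μ` is a boolean algebra basis if each element of the basis
occurs with coefficient `0` or `1` in the product of any two elements of the basis. -/
def IsBooleanAlgebraBasis {ι A : Type*} [AddCommMonoid A] [Module K A]
    (μ : A →ₗ[K] A →ₗ[K] A) (b : Module.Basis ι K A) : Prop :=
  ∀ i j k, b.repr (μ (b i) (b j)) k = 0 ∨ b.repr (μ (b i) (b j)) k = 1

/-- A basis of a coalgebra with coproduct `δ` is a boolean coalgebra basis if each element of the
tensor square of the basis occurs with coefficient `0` or `1` in the coproduct of any element of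
the basis. -/
def IsBooleanCoalgebraBasis {ι C : Type*} [AddCommMonoid C] [Module K C]
    (δ : C →ₗ[K] C ⊗[K] C) (b : Module.Basis ι K C) : Prop :=
  ∀ i j k, (b.tensorProduct b).repr (δ (b i)) (j, k) = 0 ∨
    (b.tensorProduct b).repr (δ (b i)) (j, k) = 1

end Algebra

end BaxterHopf

namespace BaxterHopf

/-! ### Left binary search trees of words -/

/-! On words without repetitions the P-symbol of `w` is the pair of left binary search trees of `w`
and of its mirror image. Each permutation thus gets a twin pair (`canopy_twinShape`), and each twin
pair arises (`exists_perm_range'_twinShape_eq`); both follow by inserting or removing the largest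
letter. Hence `P J` is the indicator function of a nonempty class of permutations: the family is
independent, and `Baxter` consists of the elements of `FQSym` that are constant on classes.

Everything then reduces to counting. The coefficient of `F π` in a product counts pairs `σ`, `ν` in
two given classes having `π` in their shifted shuffle. Since `π` and the size of `σ` determine both,
the count is 0 or 1. It depends only on the class of `π`, because restriction to an interval of
letters respects classes (`leftTree_filter_congr`).

The coefficient of `F α ⊗ F β` in a coproduct counts the cuts of permutations of one class into
words standardizing to `α` and `β`. The tree of a prefix is a top part of the whole tree, so its
shape determines its letters (`leftTree_eq_of_append_eq`) and the cut is unique. The count depends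
only on the classes of `α` and `β`, because concatenation respects classes
(`leftTree_append_congr`). -/

/-- The left binary search tree of a word. -/
def leftTree (w : List ℕ) : BinaryTree ℕ :=
  w.foldl (fun T a => leftInsert a T) .nil

@[simp] theorem leftTree_nil : leftTree [] = .nil := rfl

/-- The root never moves, so the two subtrees grow independently. This replaces iterated insertion
by a quicksort-like recursion. -/
theorem foldl_leftInsert_node (a : ℕ) (l r : BinaryTree ℕ) (w : List ℕ) :
    w.foldl (fun T a => leftInsert a T) (.node a l r) =
      .node a ((w.filter (· < a)).foldl (fun T a => leftInsert a T) l)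
        ((w.filter (a ≤ ·)).foldl (fun T a => leftInsert a T) r) := by
  induction w generalizing l r with
  | nil => rfl
  | cons b w ih =>
    by_cases h : b < a
    · simp [leftInsert, h, ih, h.not_ge]
    · simp [leftInsert, h, ih, not_lt.mp h]

theorem leftTree_cons (a : ℕ) (w : List ℕ) :
    leftTree (a :: w) =
      .node a (leftTree (w.filter (· < a))) (leftTree (w.filter (a ≤ ·))) :=
  foldl_leftInsert_node a .nil .nil w

theorem leftTree_concat (w : List ℕ) (a : ℕ) :
    leftTree (w ++ [a]) = leftInsert a (leftTree w) := by
  simp [leftTree]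

theorem leftTree_eq_nil {w : List ℕ} : leftTree w = .nil ↔ w = [] := by
  cases w with
  | nil => simp
  | cons a w => simp [leftTree_cons]

/-- Induction on words following the recursive structure of their binary search trees. -/
theorem word_induction {motive : List ℕ → Prop} (nil : motive [])
    (cons : ∀ a w, motive (w.filter (· < a)) → motive (w.filter (a ≤ ·)) → motive (a :: w))
    (w : List ℕ) : motive w := by
  induction h : w.length using Nat.strong_induction_on generalizing w with
  | _ n ih =>
    cases w with
    | nil => exact nil
    | cons a w =>
      subst h
      exact cons a w
        (ih _ (Nat.lt_succ_of_le (List.length_filter_le _ _)) _ rfl)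
        (ih _ (Nat.lt_succ_of_le (List.length_filter_le _ _)) _ rfl)

theorem length_filter_lt_add_length_filter_le (a : ℕ) (w : List ℕ) :
    (w.filter (· < a)).length + (w.filter (a ≤ ·)).length = w.length := by
  induction w with
  | nil => rfl
  | cons b w ih =>
    by_cases h : b < a
    · simp [h, h.not_ge]; omega
    · simp [h, not_lt.mp h]; omega

@[simp] theorem numNodes_leftTree (w : List ℕ) : (leftTree w).numNodes = w.length := by
  induction w using word_induction with
  | nil => rfl
  | cons a w h₁ h₂ =>
    have := length_filter_lt_add_length_filter_le a w
    simp only [leftTree_cons, BinaryTree.numNodes, h₁, h₂, List.length_cons]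
    omega

theorem filter_filter_comm {α : Type*} (p q : α → Bool) (w : List α) :
    (w.filter p).filter q = (w.filter q).filter p := by
  simp only [List.filter_filter]
  exact List.filter_congr fun x _ => Bool.and_comm _ _

/-- A root that survives the filter leaves two smaller instances. If the root is deleted, convexity
of `p` puts all surviving letters on one side of it, so a single subtree matters. -/
theorem leftTree_filter_congr {p : ℕ → Bool}
    (hp : ∀ a b c, a ≤ b → b ≤ c → p a → p c → p b) {w w' : List ℕ}
    (h : leftTree w = leftTree w') : leftTree (w.filter p) = leftTree (w'.filter p) := by
  induction w using word_induction generalizing w' with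
  | nil =>
    rw [leftTree_nil, eq_comm, leftTree_eq_nil] at h
    rw [h]
  | cons a w ih₁ ih₂ =>
    cases w' with
    | nil => simp [leftTree_cons] at h
    | cons a' w' =>
      rw [leftTree_cons, leftTree_cons] at h
      injection h with h₀ h₁ h₂
      subst h₀
      by_cases hpa : p a = true
      · rw [List.filter_cons_of_pos hpa, List.filter_cons_of_pos hpa, leftTree_cons,
          leftTree_cons, filter_filter_comm p, filter_filter_comm p, ih₁ h₁,
          filter_filter_comm p, filter_filter_comm p, ih₂ h₂]
      · rw [List.filter_cons_of_neg hpa, List.filter_cons_of_neg hpa]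
        by_cases hlow : ∃ b, b < a ∧ p b = true
        · obtain ⟨b, hb, hpb⟩ := hlow
          have key : ∀ v : List ℕ, v.filter p = (v.filter (· < a)).filter p := by
            intro v
            rw [List.filter_filter]
            refine List.filter_congr fun x _ => ?_
            by_cases hx : x < a
            · simp [hx]
            · have : ¬ p x = true := fun hpx => hpa (hp b a x hb.le (not_lt.mp hx) hpb hpx)
              simp [this]
          rw [key w, key w', ih₁ h₁]
        · have key : ∀ v : List ℕ, v.filter p = (v.filter (a ≤ ·)).filter p := by
            intro v
            rw [List.filter_filter]
            refine List.filter_congr fun x _ => ?_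
            by_cases hx : x < a
            · have : ¬ p x = true := fun hpx => hlow ⟨x, hx, hpx⟩
              simp [this]
            · simp [not_lt.mp hx]
          rw [key w, key w', ih₂ h₂]

/-- At each node of the tree of `u`, the letters of `v` are split into intervals, and
`leftTree_filter_congr` carries the hypothesis on `v` to both parts. -/
theorem leftTree_append_congr {u u' v v' : List ℕ} (hu : leftTree u = leftTree u')
    (hv : leftTree v = leftTree v') : leftTree (u ++ v) = leftTree (u' ++ v') := by
  induction u using word_induction generalizing u' v v' with
  | nil =>
    rw [leftTree_nil, eq_comm, leftTree_eq_nil] at hu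
    simpa [hu] using hv
  | cons a u ih₁ ih₂ =>
    cases u' with
    | nil => simp [leftTree_cons] at hu
    | cons a' u' =>
      rw [leftTree_cons, leftTree_cons] at hu
      injection hu with h₀ h₁ h₂
      subst h₀
      rw [List.cons_append, List.cons_append, leftTree_cons, leftTree_cons]
      simp only [List.filter_append]
      rw [ih₁ h₁ (leftTree_filter_congr _ hv), ih₂ h₂ (leftTree_filter_congr _ hv)]
      · simp only [decide_eq_true_eq]; omega
      · simp only [decide_eq_true_eq]; omega

theorem leftTree_map {f : ℕ → ℕ} {w : List ℕ}
    (hf : ∀ x ∈ w, ∀ y ∈ w, f x < f y ↔ x < y) : leftTree (w.map f) = (leftTree w).map f := by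
  induction w using word_induction with
  | nil => rfl
  | cons a w ih₁ ih₂ =>
    have hw : ∀ x ∈ w, f x < f a ↔ x < a := fun x hx => hf x (by simp [hx]) a (by simp)
    have e₁ : (w.map f).filter (· < f a) = (w.filter (· < a)).map f := by
      rw [List.filter_map]
      congr 1
      exact List.filter_congr fun x hx => by simp [hw x hx]
    have e₂ : (w.map f).filter (f a ≤ ·) = (w.filter (a ≤ ·)).map f := by
      rw [List.filter_map]
      congr 1
      exact List.filter_congr fun x hx => by
        have := hw x hx
        simp only [Function.comp_apply, decide_eq_decide]
        omega
    rw [List.map_cons, leftTree_cons, leftTree_cons, e₁, e₂, ih₁, ih₂]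
    · rfl
    · exact fun x hx y hy => hf x (List.mem_cons_of_mem _ (List.mem_of_mem_filter hx)) y
        (List.mem_cons_of_mem _ (List.mem_of_mem_filter hy))
    · exact fun x hx y hy => hf x (List.mem_cons_of_mem _ (List.mem_of_mem_filter hx)) y
        (List.mem_cons_of_mem _ (List.mem_of_mem_filter hy))

@[simp] theorem shape_nil : shape .nil = .nil := rfl

@[simp] theorem shape_node (a : ℕ) (l r : BinaryTree ℕ) :
    shape (.node a l r) = .node () (shape l) (shape r) := rfl

@[simp] theorem numNodes_shape (T : BinaryTree ℕ) : (shape T).numNodes = T.numNodes := by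
  induction T with
  | nil => rfl
  | node a l r h₁ h₂ => simp [h₁, h₂]

theorem shape_eq_nil {T : BinaryTree ℕ} : shape T = .nil ↔ T = .nil := by
  cases T <;> simp

theorem shape_map (f : ℕ → ℕ) (T : BinaryTree ℕ) : shape (T.map f) = shape T :=
  (BinaryTree.comp_map f _ T).symm

/-- The size of the left subtree is the number of letters smaller than the root, which identifies
the root within a known multiset. -/
theorem leftTree_eq_of_shape_eq {w w' : List ℕ} (hp : w.Perm w')
    (h : shape (leftTree w) = shape (leftTree w')) : leftTree w = leftTree w' := by
  induction w using word_induction generalizing w' with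
  | nil => rw [hp.nil_eq]
  | cons a w ih₁ ih₂ =>
    cases w' with
    | nil => simp at hp
    | cons a' w' =>
      simp only [leftTree_cons, shape_node, BinaryTree.node.injEq, true_and] at h
      obtain ⟨h₁, h₂⟩ := h
      have n₁ := congrArg BinaryTree.numNodes h₁
      simp only [numNodes_shape, numNodes_leftTree] at n₁
      -- If `b < c`, the letters below `c` include `b` as well as all those below `b`, hence are
      -- strictly more numerous.
      have key : ∀ {b c : ℕ} {x y : List ℕ}, (b :: x).Perm (c :: y) →
          (x.filter (· < b)).length = (y.filter (· < c)).length → ¬ b < c := by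
        intro b c x y hxy hl hbc
        have h₃ := (hxy.filter (· < c)).length_eq
        simp only [lt_irrefl, decide_false, hbc, decide_true, List.filter_cons_of_pos,
          List.length_cons, Bool.false_eq_true, not_false_eq_true,
          List.filter_cons_of_neg] at h₃
        have h₄ : (x.filter (· < b)).length ≤ (x.filter (· < c)).length := by
          rw [← List.countP_eq_length_filter, ← List.countP_eq_length_filter]
          refine List.countP_mono_left fun z _ hz => ?_
          simp only [decide_eq_true_eq] at hz ⊢
          omega
        omega
      obtain rfl : a = a' := by
        have := key hp n₁
        have := key hp.symm n₁.symm
        omega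
      have hp' : w.Perm w' := hp.cons_inv
      rw [leftTree_cons, leftTree_cons, ih₁ (hp'.filter _) h₁, ih₂ (hp'.filter _) h₂]

/-- Later insertions only add leaves below existing nodes, so the tree of `u` sits at the top of
that of `u ++ v`; its shape says which labels to read off. -/
theorem leftTree_eq_of_append_eq {u u' v v' : List ℕ}
    (h : leftTree (u ++ v) = leftTree (u' ++ v'))
    (hu : shape (leftTree u) = shape (leftTree u')) : leftTree u = leftTree u' := by
  induction u using word_induction generalizing u' v v' with
  | nil =>
    rw [leftTree_nil, shape_nil, eq_comm, shape_eq_nil] at hu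
    rw [hu, leftTree_nil]
  | cons a u ih₁ ih₂ =>
    cases u' with
    | nil => simp [leftTree_cons] at hu
    | cons a' u' =>
      simp only [leftTree_cons, shape_node, BinaryTree.node.injEq, true_and] at hu
      simp only [List.cons_append, leftTree_cons, List.filter_append,
        BinaryTree.node.injEq] at h
      obtain ⟨rfl, h₁, h₂⟩ := h
      rw [leftTree_cons, leftTree_cons, ih₁ h₁ hu.1, ih₂ h₂ hu.2]

theorem perm_of_leftTree_eq {w w' : List ℕ} (h : leftTree w = leftTree w') : w.Perm w' := by
  induction w using word_induction generalizing w' with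
  | nil =>
    rw [leftTree_nil, eq_comm, leftTree_eq_nil] at h
    rw [h]
  | cons a w ih₁ ih₂ =>
    cases w' with
    | nil => simp [leftTree_cons] at h
    | cons a' w' =>
      rw [leftTree_cons, leftTree_cons] at h
      injection h with h₀ h₁ h₂
      subst h₀
      have key : ∀ v : List ℕ, (v.filter (· < a) ++ v.filter (a ≤ ·)).Perm v := by
        intro v
        have e : v.filter (a ≤ ·) = v.filter fun x => !decide (x < a) :=
          List.filter_congr fun x _ => by simp [← decide_not]
        rw [e]
        exact List.filter_append_perm (· < a) v
      exact ((key w).symm.trans (((ih₁ h₁).append (ih₂ h₂)).trans (key w'))).cons a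

/-! ### Insertion of a maximal letter -/

/-- The number of nodes on the right spine of a tree. -/
def spine {α : Type} : BinaryTree α → ℕ
  | .nil => 0
  | .node _ _ r => spine r + 1

/-- Insertion of a new last node at a given depth on the right spine. -/
def spineInsert {α : Type} (m : α) : ℕ → BinaryTree α → BinaryTree α
  | 0, T => .node m T .nil
  | _ + 1, .nil => .node m .nil .nil
  | i + 1, .node a l r => .node a l (spineInsert m i r)

/-- Suppression of the last node. -/
def removeLast {α : Type} : BinaryTree α → BinaryTree α
  | .nil => .nil
  | .node _ l .nil => l
  | .node a l (.node b l' r') => .node a l (removeLast (.node b l' r'))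

@[simp] theorem spine_shape (T : BinaryTree ℕ) : spine (shape T) = spine T := by
  induction T with
  | nil => rfl
  | node a l r _ h => simp [spine, h]

theorem shape_spineInsert (m i : ℕ) (T : BinaryTree ℕ) :
    shape (spineInsert m i T) = spineInsert () i (shape T) := by
  induction T generalizing i with
  | nil => cases i <;> rfl
  | node a l r _ h => cases i <;> simp [spineInsert, h]

/-- The depth `i` counts the spine nodes above the last one. Removing the last node lifts its left
subtree into its place. -/
theorem exists_eq_spineInsert (T : BinaryTree Unit) (hT : T ≠ .nil) :
    ∃ i ≤ spine (removeLast T), T = spineInsert () i (removeLast T) := by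
  induction T using removeLast.induct with
  | case1 => exact absurd rfl hT
  | case2 a l => exact ⟨0, Nat.zero_le _, rfl⟩
  | case3 a l b l' r' ih =>
    obtain ⟨i, hi, h⟩ := ih (by simp)
    refine ⟨i + 1, by simpa [removeLast, spine] using hi, ?_⟩
    rw [removeLast, spineInsert, ← h]

theorem numNodes_spineInsert {α : Type} (m : α) (i : ℕ) (T : BinaryTree α) :
    (spineInsert m i T).numNodes = T.numNodes + 1 := by
  induction T generalizing i with
  | nil => cases i <;> rfl
  | node a l r _ h => cases i <;> simp [spineInsert, h]; omega

theorem leafOrientations_ne_nil {α : Type} (b : Bool) (T : BinaryTree α) :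
    leafOrientations b T ≠ [] := by
  induction T generalizing b with
  | nil => simp [leafOrientations]
  | node a l r h _ => simp [leafOrientations, h]

theorem length_leafOrientations {α : Type} (b : Bool) (T : BinaryTree α) :
    (leafOrientations b T).length = T.numNodes + 1 := by
  induction T generalizing b with
  | nil => rfl
  | node a l r h₁ h₂ => simp [leafOrientations, h₁, h₂]; omega

/-- The new node takes the spine subtree at depth `i` as left child and brings a new last leaf. The
former last leaf turns left-oriented exactly when it is itself that subtree, that is when `i` is the
full spine length. -/
theorem leafOrientations_spineInsert {α : Type} (m : α) (b : Bool) {i : ℕ} {T : BinaryTree α}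
    (hT : T ≠ .nil) (hi : i ≤ spine T) :
    leafOrientations b (spineInsert m i T) =
      (leafOrientations b T).dropLast ++ [decide (i = spine T), false] := by
  have last : ∀ (U : BinaryTree α) (c : Bool), (c = false ∨ U ≠ .nil) →
      leafOrientations c U = (leafOrientations c U).dropLast ++ [false] := by
    intro U
    induction U with
    | nil => simp [leafOrientations]
    | node a l r _ h =>
      intro c _
      rw [leafOrientations, List.dropLast_append_of_ne_nil (leafOrientations_ne_nil _ _),
        List.append_assoc, ← h false (Or.inl rfl)]
  induction T generalizing i b with
  | nil => exact absurd rfl hT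
  | node a l r _ ih =>
    cases i with
    | zero =>
      have h₁ := last (.node a l r) true (Or.inr hT)
      have h₂ : leafOrientations b (.node a l r) = leafOrientations true (.node a l r) := rfl
      rw [spineInsert, leafOrientations, h₂, h₁]
      simp [leafOrientations, spine]
    | succ i =>
      rw [spineInsert, leafOrientations, leafOrientations,
        List.dropLast_append_of_ne_nil (leafOrientations_ne_nil _ _), List.append_assoc]
      congr 1
      simp only [spine, Nat.add_le_add_iff_right] at hi
      cases r with
      | nil =>
        obtain rfl : i = 0 := by simpa [spine] using hi
        simp [spineInsert, leafOrientations, spine]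
      | node a' l' r' =>
        rw [ih false (by simp) hi]
        congr 2
        exact decide_eq_decide.mpr Nat.succ_inj.symm

theorem canopy_spineInsert {α : Type} (m : α) {i : ℕ} {T : BinaryTree α}
    (hT : T ≠ .nil) (hi : i ≤ spine T) :
    canopy (spineInsert m i T) = canopy T ++ [decide (i = spine T)] := by
  have hne : (leafOrientations true T).dropLast ≠ [] := by
    have h := length_leafOrientations true T
    have hn : 0 < T.numNodes := by
      cases T with
      | nil => exact absurd rfl hT
      | node => simp
    rw [← List.length_pos_iff, List.length_dropLast]
    omega
  rw [canopy, leafOrientations_spineInsert m true hT hi, canopy,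
    List.tail_append_of_ne_nil hne, List.dropLast_append_of_ne_nil (by simp), List.tail_dropLast]
  simp

/-- A maximal letter lands at the end of the right spine of the tree of `x`. Later letters reaching
it go to its left, building there the subtree that would have occupied its place. -/
theorem leftTree_insert_max {m : ℕ} {x y : List ℕ} (hx : ∀ z ∈ x, z < m) (hy : ∀ z ∈ y, z < m) :
    leftTree (x ++ m :: y) = spineInsert m (spine (leftTree x)) (leftTree (x ++ y)) := by
  induction x using word_induction generalizing y with
  | nil =>
    have e₁ : y.filter (· < m) = y := List.filter_eq_self.mpr (by simpa using hy)
    have e₂ : y.filter (m ≤ ·) = [] := by simpa using hy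
    simp [leftTree_cons, spine, spineInsert, e₁, e₂]
  | cons a x _ ih =>
    have ha : a < m := hx a (by simp)
    have hx' : ∀ z ∈ x.filter (a ≤ ·), z < m := fun z hz =>
      hx z (List.mem_cons_of_mem _ (List.mem_of_mem_filter hz))
    have hy' : ∀ z ∈ y.filter (a ≤ ·), z < m := fun z hz => hy z (List.mem_of_mem_filter hz)
    have e₁ : (m :: y).filter (· < a) = y.filter (· < a) :=
      List.filter_cons_of_neg (by simpa using ha.le)
    have e₂ : (m :: y).filter (a ≤ ·) = m :: y.filter (a ≤ ·) :=
      List.filter_cons_of_pos (by simpa using ha.le)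
    simp only [List.cons_append, leftTree_cons, List.filter_append, spine, spineInsert, e₁, e₂]
    rw [ih hx' hy']

/-- The right spine carries the weak left-to-right maxima of the word; letters below one already
read add none. -/
theorem spine_leftTree_append_of_max_mem {M : ℕ} {x y : List ℕ} (hM : M ∈ x)
    (hy : ∀ z ∈ y, z < M) : spine (leftTree (x ++ y)) = spine (leftTree x) := by
  induction x using word_induction generalizing y with
  | nil => simp at hM
  | cons a x _ ih =>
    simp only [List.cons_append, leftTree_cons, List.filter_append, spine]
    congr 1
    by_cases ha : M ≤ a
    · have e : y.filter (a ≤ ·) = [] := by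
        simp only [List.filter_eq_nil_iff, decide_eq_true_eq, not_le]
        exact fun z hz => (hy z hz).trans_le ha
      rw [e, List.append_nil]
    · refine ih ?_ fun z hz => hy z (List.mem_of_mem_filter hz)
      rcases List.mem_cons.mp hM with rfl | h
      · exact absurd le_rfl ha
      · simpa [h] using (not_le.mp ha).le

theorem spine_leftTree_lt_of_max_mem {M : ℕ} {x y : List ℕ} (hM : M ∈ y)
    (hx : ∀ z ∈ x, z < M) : spine (leftTree x) < spine (leftTree (x ++ y)) := by
  induction x using word_induction generalizing y with
  | nil =>
    cases y with
    | nil => simp at hM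
    | cons b y => simp [leftTree_cons, spine]
  | cons a x _ ih =>
    simp only [List.cons_append, leftTree_cons, List.filter_append, spine,
      Nat.add_lt_add_iff_right]
    refine ih ?_ fun z hz => hx z (List.mem_cons_of_mem _ (List.mem_of_mem_filter hz))
    simpa [hM] using (hx a (by simp)).le

theorem spine_leftInsert_le (a : ℕ) (T : BinaryTree ℕ) :
    spine (leftInsert a T) ≤ spine T + 1 := by
  induction T with
  | nil => simp [leftInsert, spine]
  | node b l r _ h =>
    rw [leftInsert]
    split
    · simp [spine]
    · simpa [spine] using h

/-- Discrete continuity: the spine starts at 0 and grows by at most one per letter, so no value is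
skipped. -/
theorem exists_append_spine_eq (w : List ℕ) {i : ℕ} (hi : i ≤ spine (leftTree w)) :
    ∃ x y, w = x ++ y ∧ spine (leftTree x) = i := by
  induction w using List.reverseRecOn with
  | nil => exact ⟨[], [], rfl, by simpa [spine, eq_comm] using hi⟩
  | append_singleton w a ih =>
    rcases Nat.lt_or_ge (spine (leftTree w)) i with h | h
    · refine ⟨w ++ [a], [], by simp, le_antisymm ?_ hi⟩
      rw [leftTree_concat]
      exact (spine_leftInsert_le _ _).trans h
    · obtain ⟨x, y, rfl, hx⟩ := ih h
      exact ⟨x, y ++ [a], by simp, hx⟩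

/-! ### The P-symbol of a permutation -/

theorem rightInsert_leftTree {a : ℕ} {w : List ℕ} (ha : a ∉ w) :
    rightInsert a (leftTree w) = leftInsert a (leftTree w) := by
  induction w using word_induction with
  | nil => rfl
  | cons b w h₁ h₂ =>
    rw [List.mem_cons, not_or] at ha
    rw [leftTree_cons, rightInsert, leftInsert,
      h₁ fun h => ha.2 (List.mem_of_mem_filter h), h₂ fun h => ha.2 (List.mem_of_mem_filter h)]
    have : a ≤ b ↔ a < b := ⟨fun h => lt_of_le_of_ne h ha.1, le_of_lt⟩
    simp only [this]

/-- Left and right insertion differ only on ties, which do not occur here. -/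
theorem foldr_rightInsert {w : List ℕ} (hw : w.Nodup) :
    w.foldr rightInsert .nil = leftTree w.reverse := by
  induction w with
  | nil => rfl
  | cons a w ih =>
    rw [List.nodup_cons] at hw
    rw [List.foldr_cons, ih hw.2, List.reverse_cons, leftTree_concat,
      rightInsert_leftTree (by simpa using hw.1)]

theorem nodup_of_perm_range' {n : ℕ} {w : List ℕ} (h : w.Perm (List.range' 1 n)) : w.Nodup :=
  h.nodup_iff.mpr List.nodup_range'

theorem Permutation.nodup (σ : Permutation) : σ.1.Nodup :=
  nodup_of_perm_range' σ.2

theorem isPermutation_of_perm_range' {n : ℕ} {w : List ℕ} (h : w.Perm (List.range' 1 n)) :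
    IsPermutation w := by
  have hl : w.length = n := by simpa using h.length_eq
  rwa [IsPermutation, hl]

theorem isPermutation_of_perm {w w' : List ℕ} (h : w.Perm w') (hw : IsPermutation w) :
    IsPermutation w' :=
  isPermutation_of_perm_range' (h.symm.trans hw)

theorem perm_of_length_eq {σ τ : Permutation} (h : σ.1.length = τ.1.length) : σ.1.Perm τ.1 := by
  have := τ.2.symm
  rw [← h] at this
  exact σ.2.trans this

/-- The shapes of the binary search trees of a word and of its mirror image. -/
def twinShape (w : List ℕ) : BinaryTree Unit × BinaryTree Unit :=
  (shape (leftTree w), shape (leftTree w.reverse))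

theorem pShape_eq (σ : Permutation) : pShape σ = twinShape σ.1 := by
  rw [pShape, pSymbol, foldr_rightInsert σ.nodup]
  rfl

theorem length_eq_of_twinShape_eq {w w' : List ℕ} (h : twinShape w = twinShape w') :
    w.length = w'.length := by
  simpa [twinShape] using congrArg (fun J => J.1.numNodes) h

theorem exists_of_perm_range'_succ {n : ℕ} {w : List ℕ} (h : w.Perm (List.range' 1 (n + 1))) :
    ∃ x y, w = x ++ (n + 1) :: y ∧ (x ++ y).Perm (List.range' 1 n) := by
  have hm : n + 1 ∈ w := h.mem_iff.mpr (by simp)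
  obtain ⟨x, y, rfl⟩ := List.append_of_mem hm
  refine ⟨x, y, rfl, ?_⟩
  rw [List.range'_1_concat, Nat.add_comm 1 n] at h
  exact (List.perm_middle.symm.trans (h.trans (List.perm_append_singleton _ _))).cons_inv

theorem twinShape_insert_max {n : ℕ} {x y : List ℕ} (h : (x ++ y).Perm (List.range' 1 n)) :
    twinShape (x ++ (n + 1) :: y) =
      (spineInsert () (spine (leftTree x)) (twinShape (x ++ y)).1,
        spineInsert () (spine (leftTree y.reverse)) (twinShape (x ++ y)).2) := by
  have hlt : ∀ z ∈ x ++ y, z < n + 1 := fun z hz => by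
    have := h.mem_iff.mp hz
    rw [List.mem_range'_1] at this
    omega
  have hx : ∀ z ∈ x, z < n + 1 := fun z hz => hlt z (by simp [hz])
  have hy : ∀ z ∈ y, z < n + 1 := fun z hz => hlt z (by simp [hz])
  simp only [twinShape, List.reverse_append, List.reverse_cons, List.append_assoc,
    List.singleton_append]
  rw [leftTree_insert_max hx hy, leftTree_insert_max (by simpa using hy) (by simpa using hx),
    shape_spineInsert, shape_spineInsert]

/-- The letter `n` lies in exactly one of `x` and `y`. The part containing it already has the full
spine in its reading direction, while the other part misses at least this last record. This is the
source of complementary canopies. -/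
theorem spine_eq_iff_not {n : ℕ} (hn : n ≠ 0) {x y : List ℕ}
    (h : (x ++ y).Perm (List.range' 1 n)) :
    spine (leftTree x) = spine (leftTree (x ++ y)) ↔
      ¬ spine (leftTree y.reverse) = spine (leftTree (x ++ y).reverse) := by
  have hle : ∀ z ∈ x ++ y, z ≤ n := fun z hz => by
    have := h.mem_iff.mp hz
    rw [List.mem_range'_1] at this
    omega
  have hdisj := List.disjoint_of_nodup_append (nodup_of_perm_range' h)
  have hmem : n ∈ x ++ y := h.mem_iff.mpr (by rw [List.mem_range'_1]; omega)
  rw [List.reverse_append]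
  rcases List.mem_append.mp hmem with hx | hy
  · have hy : ∀ z ∈ y, z < n := fun z hz =>
      lt_of_le_of_ne (hle z (by simp [hz])) fun e => hdisj hx (e ▸ hz)
    exact iff_of_true (spine_leftTree_append_of_max_mem hx hy).symm
      (spine_leftTree_lt_of_max_mem (by simpa using hx) (by simpa using hy)).ne
  · have hx : ∀ z ∈ x, z < n := fun z hz =>
      lt_of_le_of_ne (hle z (by simp [hz])) fun e => hdisj hz (e ▸ hy)
    refine iff_of_false (spine_leftTree_lt_of_max_mem hy hx).ne (not_not.mpr ?_)
    exact (spine_leftTree_append_of_max_mem (by simpa using hy) (by simpa using hx)).symm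

theorem spine_leftTree_append_le (x y : List ℕ) :
    spine (leftTree x) ≤ spine (leftTree (x ++ y)) := by
  induction x using word_induction generalizing y with
  | nil => simp [spine]
  | cons a x _ ih =>
    simpa only [List.cons_append, leftTree_cons, List.filter_append, spine,
      Nat.add_le_add_iff_right] using ih _

theorem twinShape_ne_nil {n : ℕ} (hn : n ≠ 0) {w : List ℕ} (h : w.Perm (List.range' 1 n)) :
    (twinShape w).1 ≠ .nil ∧ (twinShape w).2 ≠ .nil := by
  have hw : w ≠ [] := by
    rintro rfl
    simpa [hn, eq_comm] using h.length_eq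
  simpa [twinShape, shape_eq_nil, leftTree_eq_nil] using hw

theorem canopy_twinShape {n : ℕ} {w : List ℕ} (h : w.Perm (List.range' 1 n)) :
    canopy (twinShape w).1 = (canopy (twinShape w).2).map not := by
  induction n generalizing w with
  | zero =>
    obtain rfl : w = [] := by simpa using h
    rfl
  | succ n ih =>
    obtain ⟨x, y, rfl, hxy⟩ := exists_of_perm_range'_succ h
    rw [twinShape_insert_max hxy]
    -- Inserting into the empty tree adds no canopy letter, so size one is treated apart.
    by_cases hn : n = 0
    · subst hn
      obtain ⟨rfl, rfl⟩ : x = [] ∧ y = [] := by simpa using hxy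
      rfl
    · have hle := spine_leftTree_append_le y.reverse x.reverse
      rw [← List.reverse_append] at hle
      have hne := twinShape_ne_nil hn hxy
      rw [canopy_spineInsert _ hne.1 (by simpa [twinShape] using spine_leftTree_append_le x y),
        canopy_spineInsert _ hne.2 (by simpa only [twinShape, spine_shape] using hle), ih hxy]
      have := spine_eq_iff_not hn hxy
      simp only [twinShape, spine_shape, this, List.map_append, List.map_cons, List.map_nil,
        decide_not]

/-- Removing the last node of both trees drops the last letters of the canopies, so induction gives
a word `w` of size `n`. It remains to cut `w` where `n + 1` must be inserted, with prescribed spines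
`i` and `j` on the two sides. -/
theorem exists_perm_range'_twinShape_eq (n : ℕ) (J : BinaryTree Unit × BinaryTree Unit)
    (h₁ : J.1.numNodes = n) (h₂ : J.2.numNodes = n)
    (hc : canopy J.1 = (canopy J.2).map not) :
    ∃ w : List ℕ, w.Perm (List.range' 1 n) ∧ twinShape w = J := by
  induction n generalizing J with
  | zero =>
    obtain ⟨_ | ⟨a, l, r⟩, _ | ⟨a', l', r'⟩⟩ := J
    · exact ⟨[], by simp, rfl⟩
    all_goals simp at h₁ h₂
  | succ n ih =>
    obtain ⟨T₁, T₂⟩ := J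
    have ne₁ : T₁ ≠ .nil := by rintro rfl; simp at h₁
    have ne₂ : T₂ ≠ .nil := by rintro rfl; simp at h₂
    obtain ⟨i, hi, e₁⟩ := exists_eq_spineInsert T₁ ne₁
    obtain ⟨j, hj, e₂⟩ := exists_eq_spineInsert T₂ ne₂
    generalize removeLast T₁ = S₁ at *
    generalize removeLast T₂ = S₂ at *
    subst e₁ e₂
    simp only [numNodes_spineInsert, Nat.add_right_cancel_iff] at h₁ h₂
    by_cases hn : n = 0
    · subst hn
      obtain rfl : S₁ = .nil := by cases S₁ with | nil => rfl | node => simp at h₁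
      obtain rfl : S₂ = .nil := by cases S₂ with | nil => rfl | node => simp at h₂
      obtain rfl : i = 0 := by simpa [spine] using hi
      obtain rfl : j = 0 := by simpa [spine] using hj
      exact ⟨[1], by simp, rfl⟩
    · have ne₁ : S₁ ≠ .nil := by rintro rfl; exact hn h₁.symm
      have ne₂ : S₂ ≠ .nil := by rintro rfl; exact hn h₂.symm
      rw [canopy_spineInsert _ ne₁ hi, canopy_spineInsert _ ne₂ hj, List.map_append] at hc
      replace hc := List.append_inj' hc (by simp)
      obtain ⟨w, hw, e⟩ := ih (S₁, S₂) h₁ h₂ hc.1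
      have hij : i = spine S₁ ↔ ¬ j = spine S₂ := by
        have := hc.2
        simp only [List.map_cons, List.map_nil, List.cons.injEq, and_true] at this
        rwa [← decide_not, decide_eq_decide] at this
      have s₁ : spine S₁ = spine (leftTree w) := by
        rw [show S₁ = (twinShape w).1 by rw [e], twinShape, spine_shape]
      have s₂ : spine S₂ = spine (leftTree w.reverse) := by
        rw [show S₂ = (twinShape w).2 by rw [e], twinShape, spine_shape]
      suffices H : ∃ x y, w = x ++ y ∧ spine (leftTree x) = i ∧ spine (leftTree y.reverse) = j by
        obtain ⟨x, y, rfl, rfl, rfl⟩ := H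
        refine ⟨x ++ (n + 1) :: y, ?_, ?_⟩
        · rw [List.range'_1_concat, Nat.add_comm 1 n]
          exact List.perm_middle.trans
            ((hw.cons _).trans (List.perm_append_singleton _ _).symm)
        · rw [twinShape_insert_max hw, e]
      -- Exactly one of `i` and `j` is maximal. The cut is chosen to realize the other one, and
      -- `spine_eq_iff_not` then forces the maximal one.
      by_cases h : i = spine S₁
      · obtain ⟨y, x, exy, hy⟩ := exists_append_spine_eq w.reverse (s₂ ▸ hj)
        obtain rfl : w = x.reverse ++ y.reverse := by
          rw [← List.reverse_append, ← exy, List.reverse_reverse]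
        have := spine_eq_iff_not hn hw
        refine ⟨x.reverse, y.reverse, rfl, ?_, by simpa using hy⟩
        rw [h, s₁, this, List.reverse_reverse, hy, ← s₂]
        exact hij.mp h
      · obtain ⟨x, y, rfl, hx⟩ := exists_append_spine_eq w (s₁ ▸ hi)
        refine ⟨x, y, rfl, hx, ?_⟩
        have := spine_eq_iff_not hn hw
        rw [hx, ← s₁, ← s₂] at this
        rw [not_not.mp (mt this.mpr h), not_not.mp (mt hij.mpr h)]

/-- The pair of twin binary trees of a permutation. -/
def twinPair (σ : Permutation) : TwinPair :=
  ⟨twinShape σ.1, by simp [twinShape], canopy_twinShape σ.2⟩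

theorem twinPair_eq_iff {σ τ : Permutation} :
    twinPair σ = twinPair τ ↔ twinShape σ.1 = twinShape τ.1 :=
  Subtype.ext_iff

theorem twinPair_surjective : Function.Surjective twinPair := by
  rintro ⟨J, h, hc⟩
  obtain ⟨w, hw, e⟩ := exists_perm_range'_twinShape_eq _ J rfl h.symm hc
  exact ⟨⟨w, isPermutation_of_perm_range' hw⟩, Subtype.ext e⟩

theorem mem_filter_pShape {σ : Permutation} {J : TwinPair} :
    σ ∈ (permutationsOfSize J.1.1.numNodes).filter (fun σ => pShape σ = J.1) ↔
      twinPair σ = J := by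
  rw [Finset.mem_filter, mem_permutationsOfSize, pShape_eq, Subtype.ext_iff]
  refine ⟨And.right, fun h => ⟨?_, h⟩⟩
  rw [← h]
  simp [twinPair, twinShape]

/-! ### Words with the same trees -/

theorem leftTree_eq_of_twinShape_eq {w w' : List ℕ} (hp : w.Perm w')
    (h : twinShape w = twinShape w') :
    leftTree w = leftTree w' ∧ leftTree w.reverse = leftTree w'.reverse := by
  rw [twinShape, twinShape, Prod.mk.injEq] at h
  exact ⟨leftTree_eq_of_shape_eq hp h.1, leftTree_eq_of_shape_eq
    ((List.reverse_perm w).trans (hp.trans (List.reverse_perm w').symm)) h.2⟩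

theorem twinShape_filter_congr {p : ℕ → Bool}
    (hp : ∀ a b c, a ≤ b → b ≤ c → p a → p c → p b) {w w' : List ℕ} (hw : w.Perm w')
    (h : twinShape w = twinShape w') : twinShape (w.filter p) = twinShape (w'.filter p) := by
  obtain ⟨h₁, h₂⟩ := leftTree_eq_of_twinShape_eq hw h
  rw [twinShape, twinShape, leftTree_filter_congr hp h₁, ← List.filter_reverse,
    ← List.filter_reverse, leftTree_filter_congr hp h₂]

theorem twinShape_append_congr {u u' v v' : List ℕ} (hu : u.Perm u') (hv : v.Perm v')
    (h₁ : twinShape u = twinShape u') (h₂ : twinShape v = twinShape v') :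
    twinShape (u ++ v) = twinShape (u' ++ v') := by
  obtain ⟨a₁, a₂⟩ := leftTree_eq_of_twinShape_eq hu h₁
  obtain ⟨b₁, b₂⟩ := leftTree_eq_of_twinShape_eq hv h₂
  rw [twinShape, twinShape, leftTree_append_congr a₁ b₁, List.reverse_append,
    List.reverse_append, leftTree_append_congr b₂ a₂]

theorem twinShape_map {f : ℕ → ℕ} {w : List ℕ}
    (hf : ∀ x ∈ w, ∀ y ∈ w, f x < f y ↔ x < y) : twinShape (w.map f) = twinShape w := by
  rw [twinShape, twinShape, ← List.map_reverse, leftTree_map hf,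
    leftTree_map (by simpa using hf), shape_map, shape_map]

/-! ### Standardization -/

theorem card_filter_getElem (u : List ℕ) (q : ℕ → Prop) [DecidablePred q] :
    (Finset.univ.filter fun j : Fin u.length => q u[j]).card = u.countP q := by
  conv_rhs => rw [← List.map_get_finRange u, List.countP_map, List.countP_eq_length_filter]
  rfl

/-- The standardization of a word without repetitions ranks its letters. -/
theorem stdWord_eq_map {u : List ℕ} (hu : u.Nodup) :
    stdWord u = u.map fun x => u.countP (· ≤ x) := by
  conv_rhs => rw [← List.map_get_finRange u]
  rw [stdWord, List.map_map]
  refine List.map_congr_left fun i _ => ?_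
  rw [Function.comp_apply, List.map_get_finRange, ← card_filter_getElem]
  congr 1
  ext j
  have : u[j] = u[i] → j = i := fun h => Fin.ext (hu.getElem_inj_iff.mp h)
  simp only [Finset.mem_filter, Finset.mem_univ, true_and, List.get_eq_getElem]
  constructor
  · rintro (h | h)
    · exact h.le
    · exact h.1.le
  · intro h
    rcases lt_or_eq_of_le h with h | h
    · exact Or.inl h
    · exact Or.inr ⟨h, (this h).le⟩

theorem countP_le_lt_iff {u : List ℕ} {x y : ℕ} (hy : y ∈ u) :
    u.countP (· ≤ x) < u.countP (· ≤ y) ↔ x < y := by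
  have mono : ∀ {a b : ℕ}, a ≤ b → u.countP (· ≤ a) ≤ u.countP (· ≤ b) := fun hab =>
    List.countP_mono_left fun z _ hz => by
      simp only [decide_eq_true_eq] at hz ⊢
      omega
  refine ⟨fun h => lt_of_not_ge fun hyx => h.not_ge (mono hyx), fun h => ?_⟩
  obtain ⟨s, t, rfl⟩ := List.append_of_mem hy
  have key : ∀ v : List ℕ, v.countP (· ≤ x) ≤ v.countP (· ≤ y) := fun v =>
    List.countP_mono_left fun z _ hz => by
      simp only [decide_eq_true_eq] at hz ⊢
      omega
  have hs := key s
  have ht := key t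
  simp only [List.countP_append, List.countP_cons, le_refl, decide_true, if_true,
    decide_eq_true_eq, h.not_ge, if_false]
  omega

theorem length_stdWord (u : List ℕ) : (stdWord u).length = u.length := by
  simp [stdWord]

theorem twinShape_stdWord {u : List ℕ} (hu : u.Nodup) : twinShape (stdWord u) = twinShape u := by
  rw [stdWord_eq_map hu]
  exact twinShape_map fun x _ y hy => countP_le_lt_iff hy

/-- Both words are standardized by the same rank function, since it depends only on the multiset of
letters; it is injective on them. -/
theorem eq_of_perm_of_stdWord_eq {u u' : List ℕ} (hu : u.Nodup) (hp : u.Perm u')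
    (h : stdWord u = stdWord u') : u = u' := by
  rw [stdWord_eq_map hu, stdWord_eq_map (hp.nodup_iff.mp hu)] at h
  simp only [← hp.countP_eq] at h
  have hinj : ∀ x ∈ u, ∀ y ∈ u, u.countP (· ≤ x) = u.countP (· ≤ y) → x = y := by
    intro x hx y hy e
    have h₁ := countP_le_lt_iff (x := x) hy
    have h₂ := countP_le_lt_iff (x := y) hx
    omega
  have hl : u.length = u'.length := hp.length_eq
  refine List.ext_getElem hl fun i hi hi' => hinj _ (List.getElem_mem _) _
    (hp.mem_iff.mpr (List.getElem_mem _)) ?_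
  simpa [hi, hi'] using congrArg (·[i]?) h

theorem exists_perm_stdWord_eq {u : List ℕ} (hu : u.Nodup) (α : Permutation)
    (h : α.1.length = u.length) : ∃ u' : List ℕ, u'.Perm u ∧ stdWord u' = α.1 := by
  have hp : α.1.Perm (u.map fun x => u.countP (· ≤ x)) := by
    rw [← stdWord_eq_map hu]
    exact perm_of_length_eq (τ := std u) (by rw [h]; exact (length_stdWord u).symm)
  -- A rearrangement of the image of `u` under the rank function is the image of a rearrangement of
  -- `u`.
  obtain ⟨u', e, hu'⟩ := (congrFun₂ (List.eq_map_comp_perm _) _ _).mpr hp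
  refine ⟨u', hu', ?_⟩
  rw [stdWord_eq_map (hu'.nodup_iff.mpr hu), e]
  simp only [hu'.countP_eq]

/-! ### Structure coefficients of the product -/

theorem count_map_cons (a c : ℕ) (w : List ℕ) (l : List (List ℕ)) :
    (l.map (List.cons a)).count (c :: w) = if c = a then l.count w else 0 := by
  split
  · next h =>
    subst h
    exact List.count_map_of_injective _ _ List.cons_injective _
  · next h =>
    rw [List.count_eq_zero]
    simp only [List.mem_map, List.cons.injEq, not_exists, not_and]
    exact fun _ _ e => absurd e.symm h

/-- As `p` separates the two alphabets, the first letter of `w` tells which word it came from, and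
only one branch of the recursion can contribute. -/
theorem count_shuffle {p : ℕ → Bool} (u v w : List ℕ) (hu : ∀ a ∈ u, p a = true)
    (hv : ∀ a ∈ v, p a = false) :
    (shuffle u v).count w =
      if w.filter p = u ∧ w.filter (fun a => !p a) = v then 1 else 0 := by
  induction u, v using shuffle.induct generalizing w with
  | case1 v =>
    rw [shuffle, List.count_singleton]
    have : v = w ↔ w.filter p = [] ∧ w.filter (fun a => !p a) = v := by
      constructor
      · rintro rfl
        simp only [List.filter_eq_nil_iff, List.filter_eq_self]
        exact ⟨fun a ha => by simp [hv a ha], fun a ha => by simp [hv a ha]⟩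
      · rintro ⟨h₁, rfl⟩
        rw [List.filter_eq_self]
        simpa [List.filter_eq_nil_iff] using h₁
    simp only [beq_iff_eq, this]
  | case2 a u =>
    rw [shuffle, List.count_singleton]
    have : a :: u = w ↔ w.filter p = a :: u ∧ w.filter (fun a => !p a) = [] := by
      constructor
      · rintro rfl
        simp only [List.filter_eq_nil_iff, List.filter_eq_self]
        exact ⟨hu, fun b hb => by simp [hu b hb]⟩
      · rintro ⟨h₁, h₂⟩
        rw [← h₁, List.filter_eq_self]
        simpa [List.filter_eq_nil_iff] using h₂
    simp only [beq_iff_eq, this]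
  | case3 a u b v ih₁ ih₂ =>
    have ha : p a = true := hu a (by simp)
    have hb : p b = false := hv b (by simp)
    rw [shuffle, List.count_append]
    cases w with
    | nil => simp [List.count_eq_zero]
    | cons c w =>
      rw [count_map_cons, count_map_cons, ih₁ w (fun x hx => hu x (by simp [hx])) hv,
        ih₂ w hu (fun x hx => hv x (by simp [hx]))]
      cases hc : p c
      · have hca : c ≠ a := by rintro rfl; simp [hc] at ha
        simp [hc, hca, ← ite_and, and_left_comm]
      · have hcb : c ≠ b := by rintro rfl; simp [hc] at hb
        simp [hc, hcb, ← ite_and, and_assoc]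

/-- The permutation `π` occurs in the shifted shuffle of `σ` and `ν`. -/
def IsShiftedShuffle (σ ν π : Permutation) : Prop :=
  π.1.filter (· ≤ σ.1.length) = σ.1 ∧
    π.1.filter (fun a => !decide (a ≤ σ.1.length)) = ν.1.map (· + σ.1.length)

open Classical in
theorem count_shiftedShuffle (σ ν π : Permutation) :
    (shiftedShuffle σ.1 ν.1).count π.1 = if IsShiftedShuffle σ ν π then 1 else 0 := by
  rw [shiftedShuffle, count_shuffle (p := (· ≤ σ.1.length)), IsShiftedShuffle]
  · congr
  · intro a ha
    have := σ.2.mem_iff.mp ha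
    rw [List.mem_range'_1] at this
    simp only [decide_eq_true_eq]
    omega
  · intro a ha
    obtain ⟨b, hb, rfl⟩ := List.mem_map.mp ha
    have := ν.2.mem_iff.mp hb
    rw [List.mem_range'_1] at this
    simp only [decide_eq_false_iff_not]
    omega

theorem length_eq_of_twinPair_eq {σ τ : Permutation} (h : twinPair σ = twinPair τ) :
    σ.1.length = τ.1.length :=
  length_eq_of_twinShape_eq (twinPair_eq_iff.mp h)

theorem perm_of_twinPair_eq {σ τ : Permutation} (h : twinPair σ = twinPair τ) :
    σ.1.Perm τ.1 :=
  perm_of_length_eq (length_eq_of_twinPair_eq h)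

theorem IsShiftedShuffle.unique {σ ν σ' ν' π : Permutation} (h : IsShiftedShuffle σ ν π)
    (h' : IsShiftedShuffle σ' ν' π) (hl : σ.1.length = σ'.1.length) : σ = σ' ∧ ν = ν' := by
  obtain ⟨h₁, h₂⟩ := h
  obtain ⟨h₁', h₂'⟩ := h'
  rw [← hl] at h₁' h₂'
  refine ⟨Subtype.ext (h₁.symm.trans h₁'), Subtype.ext ?_⟩
  exact List.map_injective_iff.mpr (add_left_injective _) (h₂.symm.trans h₂')

/-- The new factors are the small letters of `π'` and its large letters shifted back. Both sets of
letters are convex, so restriction preserves classes. -/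
theorem IsShiftedShuffle.exists_of_twinPair_eq {σ ν π π' : Permutation}
    (h : IsShiftedShuffle σ ν π) (hπ : twinPair π = twinPair π') :
    ∃ σ' ν', twinPair σ' = twinPair σ ∧ twinPair ν' = twinPair ν ∧
      IsShiftedShuffle σ' ν' π' := by
  obtain ⟨h₁, h₂⟩ := h
  set n := σ.1.length with hn
  have hp := perm_of_twinPair_eq hπ
  have hs := twinPair_eq_iff.mp hπ
  have p₁ := hp.filter (· ≤ n)
  have p₂ := hp.filter (fun a => !decide (a ≤ n))
  have t₁ := twinShape_filter_congr (p := (· ≤ n)) (by simp; omega) hp hs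
  have t₂ := twinShape_filter_congr (p := fun a => !decide (a ≤ n)) (by simp; omega) hp hs
  rw [h₁] at p₁ t₁
  rw [h₂] at p₂ t₂
  have hsub : (ν.1.map (· + n)).map (· - n) = ν.1 := by simp [Function.comp_def]
  -- On these letters the truncated subtraction of `n` preserves order and is undone by adding `n`.
  have hgt : ∀ a ∈ π'.1.filter (fun a => !decide (a ≤ n)), n < a := by simp
  have p₃ := p₂.map (· - n)
  rw [hsub] at p₃
  refine ⟨⟨_, isPermutation_of_perm p₁ σ.2⟩, ⟨_, isPermutation_of_perm p₃ ν.2⟩,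
    twinPair_eq_iff.mpr t₁.symm, twinPair_eq_iff.mpr ?_, ?_, ?_⟩
  · change twinShape (List.map _ _) = _
    rw [twinShape_map, ← t₂, twinShape_map]
    · simp
    · intro x hx y hy
      have := hgt x hx
      have := hgt y hy
      omega
  · rw [← p₁.length_eq]
  · rw [← p₁.length_eq, List.map_map]
    refine Eq.symm ((List.map_congr_left (g := id) fun a ha => ?_).trans (List.map_id _))
    exact Nat.sub_add_cancel (hgt a ha).le

/-! ### Structure coefficients of the coproduct -/

/-- The permutation `σ` is the concatenation of a word of standardization `α` and of a word of
standardization `β`. -/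
def IsConcatenation (α β σ : Permutation) (i : ℕ) : Prop :=
  std (σ.1.take i) = α ∧ std (σ.1.drop i) = β

theorem IsConcatenation.eq_length {α β σ : Permutation} {i : ℕ} (h : IsConcatenation α β σ i)
    (hi : i ≤ σ.1.length) : i = α.1.length := by
  have := congrArg (fun α : Permutation => α.1.length) h.1
  simp only [std, length_stdWord, List.length_take] at this
  omega

/-- The two prefixes have trees of the same shape, at the top of the same tree, hence the same
letters; equal standardizations make them equal. Cancelling them leaves suffixes with the same
letters, which are equal likewise. -/
theorem IsConcatenation.unique {α β σ σ' : Permutation} {i i' : ℕ}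
    (h : IsConcatenation α β σ i) (h' : IsConcatenation α β σ' i')
    (hi : i ≤ σ.1.length) (hi' : i' ≤ σ'.1.length) (hσ : twinPair σ = twinPair σ') :
    σ = σ' ∧ i = i' := by
  obtain rfl : i = i' := (h.eq_length hi).trans (h'.eq_length hi').symm
  refine ⟨Subtype.ext ?_, rfl⟩
  have hp := perm_of_twinPair_eq hσ
  have hL := (leftTree_eq_of_twinShape_eq hp (twinPair_eq_iff.mp hσ)).1
  have e₁ : stdWord (σ.1.take i) = stdWord (σ'.1.take i) :=
    congrArg Subtype.val (h.1.trans h'.1.symm)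
  have e₂ : stdWord (σ.1.drop i) = stdWord (σ'.1.drop i) :=
    congrArg Subtype.val (h.2.trans h'.2.symm)
  have nt : (σ.1.take i).Nodup := σ.nodup.sublist (List.take_sublist _ _)
  have nt' : (σ'.1.take i).Nodup := σ'.nodup.sublist (List.take_sublist _ _)
  have nd : (σ.1.drop i).Nodup := σ.nodup.sublist (List.drop_sublist _ _)
  have s := (twinShape_stdWord nt).symm.trans ((congrArg _ e₁).trans (twinShape_stdWord nt'))
  rw [← List.take_append_drop i σ.1, ← List.take_append_drop i σ'.1] at hL hp
  have pt := perm_of_leftTree_eq (leftTree_eq_of_append_eq hL (congrArg Prod.fst s))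
  have et := eq_of_perm_of_stdWord_eq nt pt e₁
  rw [et, List.perm_append_left_iff] at hp
  have ed := eq_of_perm_of_stdWord_eq nd hp e₂
  rw [← List.take_append_drop i σ.1, ← List.take_append_drop i σ'.1, et, ed]

/-- The letters of the prefix are reordered following `α'` and those of the suffix following `β'`.
The cut is at the true prefix length because `i` may exceed the size of `σ`. -/
theorem IsConcatenation.exists_of_twinPair_eq {α β α' β' σ : Permutation} {i : ℕ}
    (h : IsConcatenation α β σ i) (hα : twinPair α = twinPair α')
    (hβ : twinPair β = twinPair β') :
    ∃ σ' : Permutation, twinPair σ' = twinPair σ ∧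
      IsConcatenation α' β' σ' (σ.1.take i).length := by
  have key : ∀ {u : List ℕ} {α α' : Permutation}, u.Nodup → std u = α →
      twinPair α = twinPair α' →
      ∃ u' : List ℕ, u'.Perm u ∧ std u' = α' ∧ twinShape u' = twinShape u := by
    intro u α α' hu e h
    subst e
    obtain ⟨u', hp, e⟩ := exists_perm_stdWord_eq hu α'
      ((length_eq_of_twinPair_eq h).symm.trans (length_stdWord u))
    refine ⟨u', hp, Subtype.ext e, ?_⟩
    rw [← twinShape_stdWord hu, ← twinShape_stdWord (hp.nodup_iff.mpr hu), e]
    exact (twinPair_eq_iff.mp h).symm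
  obtain ⟨u', pu, eu, tu⟩ := key (σ.nodup.sublist (List.take_sublist i _)) h.1 hα
  obtain ⟨v', pv, ev, tv⟩ := key (σ.nodup.sublist (List.drop_sublist i _)) h.2 hβ
  have hp := pu.append pv
  have ht := twinShape_append_congr pu pv tu tv
  rw [List.take_append_drop] at hp ht
  refine ⟨⟨u' ++ v', isPermutation_of_perm hp.symm σ.2⟩, twinPair_eq_iff.mpr ht, ?_, ?_⟩
  · rw [← pu.length_eq]
    simpa using eu
  · rw [← pu.length_eq]
    simpa using ev

/-! ### Functions that are constant on the classes -/

section Algebra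

variable (K : Type*) [Field K]

open Classical in
-- Turns a uniqueness statement into a coefficient 0 or 1; used for both the product and the
-- coproduct.
theorem sum_boole_of_unique {ι : Type*} (s : Finset ι) (R : ι → Prop)
    (h : ∀ i ∈ s, ∀ j ∈ s, R i → R j → i = j) :
    ∑ i ∈ s, (if R i then (1 : K) else 0) = if ∃ i ∈ s, R i then 1 else 0 := by
  split
  · next hR =>
    obtain ⟨i, hi, hRi⟩ := hR
    rw [Finset.sum_eq_single_of_mem i hi, if_pos hRi]
    exact fun j hj hji => if_neg fun hRj => hji (h j hj i hi hRj hRi)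
  · next hR =>
    exact Finset.sum_eq_zero fun i hi => if_neg fun hRi => hR ⟨i, hi, hRi⟩

open Classical in
theorem F_apply (σ τ : Permutation) : F K σ τ = if σ = τ then 1 else 0 := by
  rw [F, Finsupp.single_apply]

/-- The permutations with a given pair of twin binary trees. -/
def fiber (J : TwinPair) : Finset Permutation :=
  (permutationsOfSize J.1.1.numNodes).filter (fun σ => pShape σ = J.1)

theorem mem_fiber {J : TwinPair} {σ : Permutation} : σ ∈ fiber J ↔ twinPair σ = J :=
  mem_filter_pShape

theorem P_eq_sum (J : TwinPair) : P K J = ∑ σ ∈ fiber J, F K σ := rfl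

open Classical in
theorem P_apply (J : TwinPair) (σ : Permutation) :
    P K J σ = if twinPair σ = J then 1 else 0 := by
  simp only [P_eq_sum, Finsupp.finsetSum_apply, F_apply, Finset.sum_ite_eq', mem_fiber]

theorem linearCombination_P_apply (c : TwinPair →₀ K) (σ : Permutation) :
    Finsupp.linearCombination K (P K) c σ = c (twinPair σ) := by
  classical
  rw [Finsupp.linearCombination_apply, Finsupp.sum, Finsupp.finsetSum_apply]
  simp +contextual [P_apply]

/-- No class is empty, so each coefficient of a combination is its value at some permutation. -/
theorem linearIndependent_P : LinearIndependent K (P K) := by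
  rw [linearIndependent_iff]
  intro c hc
  ext J
  obtain ⟨σ, rfl⟩ := twinPair_surjective J
  rw [← linearCombination_P_apply, hc]
  rfl

/-- A permutation with a given pair of twin binary trees. -/
noncomputable def representative : TwinPair → Permutation :=
  Function.surjInv twinPair_surjective

@[simp] theorem twinPair_representative (J : TwinPair) : twinPair (representative J) = J :=
  Function.surjInv_eq twinPair_surjective J

theorem representative_injective : Function.Injective representative :=
  Function.injective_surjInv twinPair_surjective

/-- The coordinates are the values at class representatives; injectivity of `representative` keeps
the support finite. -/
theorem mem_Baxter_of_forall {x : FQSym K}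
    (h : ∀ σ τ, twinPair σ = twinPair τ → x σ = x τ) : x ∈ Baxter K := by
  rw [Baxter, ← Finsupp.range_linearCombination]
  refine ⟨x.comapDomain representative representative_injective.injOn, ?_⟩
  ext σ
  rw [linearCombination_P_apply, Finsupp.comapDomain_apply]
  exact h _ _ (twinPair_representative _)

/-- The basis `P` of `Baxter`. -/
noncomputable def basisP : Module.Basis TwinPair K (Baxter K) :=
  Module.Basis.span (linearIndependent_P K)

theorem basisP_apply (J : TwinPair) : (basisP K J : FQSym K) = P K J :=
  congrArg Subtype.val (Module.Basis.span_apply (linearIndependent_P K) J)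

theorem basisP_repr_apply (x : Baxter K) (σ : Permutation) :
    (basisP K).repr x (twinPair σ) = x.1 σ := by
  conv_rhs => rw [← (basisP K).linearCombination_repr x]
  rw [← linearCombination_P_apply, ← Submodule.subtype_apply, Finsupp.apply_linearCombination]
  congr 3
  ext1 J
  exact (basisP_apply K J).symm

/-! ### The product -/

theorem sum_pmap_F_apply (l : List (List ℕ)) (h : ∀ w ∈ l, IsPermutation w) (π : Permutation) :
    (l.pmap (fun w hw => F K ⟨w, hw⟩) h).sum π = (l.count π.1 : K) := by
  induction l with
  | nil => simp
  | cons w l ih =>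
    rw [List.pmap_cons, List.sum_cons, Finsupp.add_apply, ih, F_apply, List.count_cons]
    by_cases hw : w = π.1
    · simp [hw, add_comm]
    · simp [hw, Subtype.ext_iff]

open Classical in
theorem mul_F_apply (σ ν π : Permutation) :
    FQSym.mul K (F K σ) (F K ν) π = if IsShiftedShuffle σ ν π then 1 else 0 := by
  rw [FQSym.mul, F, F, Finsupp.linearCombination_single, one_smul,
    Finsupp.linearCombination_single, one_smul, sum_pmap_F_apply, count_shiftedShuffle]
  split <;> simp

open Classical in
theorem mul_P_apply (J₀ J₁ : TwinPair) (π : Permutation) :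
    FQSym.mul K (P K J₀) (P K J₁) π =
      if ∃ σ ν, twinPair σ = J₀ ∧ twinPair ν = J₁ ∧ IsShiftedShuffle σ ν π then 1 else 0 := by
  have h := sum_boole_of_unique K (fiber J₀ ×ˢ fiber J₁)
    (fun x => IsShiftedShuffle x.1 x.2 π) (by
      intro x hx y hy hRx hRy
      simp only [Finset.mem_product, mem_fiber] at hx hy
      exact Prod.ext_iff.mpr
        (hRx.unique hRy (length_eq_of_twinPair_eq (hx.1.trans hy.1.symm))))
  simp only [Finset.mem_product, mem_fiber, Prod.exists, and_assoc, Finset.sum_product] at h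
  rw [← h, P_eq_sum, P_eq_sum, map_sum (FQSym.mul K), LinearMap.sum_apply,
    Finsupp.finsetSum_apply]
  refine Finset.sum_congr rfl fun σ _ => ?_
  rw [map_sum, Finsupp.finsetSum_apply]
  exact Finset.sum_congr rfl fun ν _ => mul_F_apply K σ ν π

theorem mul_P_mem (J₀ J₁ : TwinPair) : FQSym.mul K (P K J₀) (P K J₁) ∈ Baxter K := by
  classical
  have key : ∀ {π π' : Permutation}, twinPair π = twinPair π' →
      (∃ σ ν, twinPair σ = J₀ ∧ twinPair ν = J₁ ∧ IsShiftedShuffle σ ν π) →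
      ∃ σ ν, twinPair σ = J₀ ∧ twinPair ν = J₁ ∧ IsShiftedShuffle σ ν π' := by
    rintro π π' hπ ⟨σ, ν, rfl, rfl, h⟩
    exact h.exists_of_twinPair_eq hπ
  refine mem_Baxter_of_forall K fun π π' h => ?_
  rw [mul_P_apply, mul_P_apply]
  exact if_congr ⟨key h, key h.symm⟩ rfl rfl

theorem mul_mem_Baxter {x y : FQSym K} (hx : x ∈ Baxter K) (hy : y ∈ Baxter K) :
    FQSym.mul K x y ∈ Baxter K := by
  refine Submodule.map₂_le.mp ?_ x hx y hy
  rw [Baxter, Submodule.map₂_span_span, Submodule.span_le]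
  rintro _ ⟨_, ⟨J₀, rfl⟩, _, ⟨J₁, rfl⟩, rfl⟩
  exact mul_P_mem K J₀ J₁

/-- The product of `Baxter`. -/
noncomputable def Baxter.mul : Baxter K →ₗ[K] Baxter K →ₗ[K] Baxter K :=
  LinearMap.mk₂ K (fun x y => ⟨FQSym.mul K x y, mul_mem_Baxter K x.2 y.2⟩)
    (fun _ _ _ => Subtype.ext (by simp)) (fun _ _ _ => Subtype.ext (by simp))
    (fun _ _ _ => Subtype.ext (by simp)) (fun _ _ _ => Subtype.ext (by simp))

theorem isBooleanAlgebraBasis_basisP : IsBooleanAlgebraBasis (Baxter.mul K) (basisP K) := by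
  classical
  intro J₀ J₁ J
  obtain ⟨π, rfl⟩ := twinPair_surjective J
  rw [basisP_repr_apply]
  change FQSym.mul K (basisP K J₀ : FQSym K) (basisP K J₁) π = 0 ∨
    FQSym.mul K (basisP K J₀ : FQSym K) (basisP K J₁) π = 1
  rw [basisP_apply, basisP_apply, mul_P_apply]
  exact (ite_eq_or_eq _ _ _).symm

/-! ### The coproduct -/

/-- The coefficients of an element of the tensor square of `FQSym`. -/
noncomputable def tensorCoeff : FQSym K ⊗[K] FQSym K ≃ₗ[K] (Permutation × Permutation →₀ K) :=
  finsuppTensorFinsupp' K Permutation Permutation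

theorem tensorCoeff_tmul (x y : FQSym K) (α β : Permutation) :
    tensorCoeff K (x ⊗ₜ y) (α, β) = x α * y β :=
  finsuppTensorFinsupp'_apply_apply ..

open Classical in
theorem tensorCoeff_comul_F (σ α β : Permutation) :
    tensorCoeff K (FQSym.comul K (F K σ)) (α, β) =
      ∑ i ∈ Finset.range (σ.1.length + 1), if IsConcatenation α β σ i then 1 else 0 := by
  rw [FQSym.comul, F, Finsupp.linearCombination_single, one_smul, map_sum,
    Finsupp.finsetSum_apply]
  refine Finset.sum_congr rfl fun i _ => ?_
  rw [tensorCoeff_tmul, F_apply, F_apply, ite_zero_mul_ite_zero, one_mul]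
  exact if_congr Iff.rfl rfl rfl

open Classical in
theorem tensorCoeff_comul_P (J : TwinPair) (α β : Permutation) :
    tensorCoeff K (FQSym.comul K (P K J)) (α, β) =
      if ∃ (σ : Permutation) (i : ℕ), twinPair σ = J ∧ i ≤ σ.1.length ∧ IsConcatenation α β σ i
      then 1 else 0 := by
  have h := sum_boole_of_unique K
    ((fiber J).sigma fun σ => Finset.range (σ.1.length + 1))
    (fun x => IsConcatenation α β x.1 x.2) (by
      rintro ⟨σ, i⟩ hx ⟨σ', i'⟩ hy hRx hRy
      simp only [Finset.mem_sigma, mem_fiber, Finset.mem_range, Nat.lt_succ_iff] at hx hy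
      obtain ⟨rfl, rfl⟩ := hRx.unique hRy hx.2 hy.2 (hx.1.trans hy.1.symm)
      rfl)
  simp only [Finset.mem_sigma, mem_fiber, Finset.mem_range, Nat.lt_succ_iff, Sigma.exists,
    and_assoc, Finset.sum_sigma] at h
  rw [← h, P_eq_sum, map_sum, map_sum, Finsupp.finsetSum_apply]
  exact Finset.sum_congr rfl fun σ _ => tensorCoeff_comul_F K σ α β

theorem tensorCoeff_comul_P_congr (J : TwinPair) {α β α' β' : Permutation}
    (hα : twinPair α = twinPair α') (hβ : twinPair β = twinPair β') :
    tensorCoeff K (FQSym.comul K (P K J)) (α, β) =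
      tensorCoeff K (FQSym.comul K (P K J)) (α', β') := by
  classical
  have key : ∀ {α β α' β' : Permutation}, twinPair α = twinPair α' → twinPair β = twinPair β' →
      (∃ (σ : Permutation) (i : ℕ), twinPair σ = J ∧ i ≤ σ.1.length ∧ IsConcatenation α β σ i) →
      ∃ (σ : Permutation) (i : ℕ), twinPair σ = J ∧ i ≤ σ.1.length ∧
        IsConcatenation α' β' σ i := by
    rintro α β α' β' hα hβ ⟨σ, i, rfl, -, h⟩
    obtain ⟨σ', hσ', h'⟩ := h.exists_of_twinPair_eq hα hβ
    refine ⟨σ', _, hσ', ?_, h'⟩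
    rw [length_eq_of_twinPair_eq hσ']
    exact List.length_take_le' _ _
  rw [tensorCoeff_comul_P, tensorCoeff_comul_P]
  exact if_congr ⟨key hα hβ, key hα.symm hβ.symm⟩ rfl rfl

/-- The coefficients of the coproduct of `P J`. -/
noncomputable def comulCoeff (J : TwinPair) : TwinPair × TwinPair →₀ K :=
  (tensorCoeff K (FQSym.comul K (P K J))).comapDomain (Prod.map representative representative)
    (representative_injective.prodMap representative_injective).injOn

/-- The coproduct of `Baxter`. -/
noncomputable def Baxter.comul : Baxter K →ₗ[K] Baxter K ⊗[K] Baxter K :=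
  (basisP K).constr K fun J => ((basisP K).tensorProduct (basisP K)).repr.symm (comulCoeff K J)

theorem Baxter.comul_basisP (J : TwinPair) :
    Baxter.comul K (basisP K J) =
      ((basisP K).tensorProduct (basisP K)).repr.symm (comulCoeff K J) :=
  Module.Basis.constr_basis _ _ _ _

theorem tensorCoeff_map_subtype (g : TwinPair × TwinPair →₀ K) (α β : Permutation) :
    tensorCoeff K (TensorProduct.map (Baxter K).subtype (Baxter K).subtype
      (((basisP K).tensorProduct (basisP K)).repr.symm g)) (α, β) =
      g (twinPair α, twinPair β) := by
  classical
  induction g using Finsupp.induction_linear with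
  | zero => simp
  | add f g hf hg => simp only [map_add, Finsupp.add_apply, hf, hg]
  | single J r =>
    obtain ⟨J₀, J₁⟩ := J
    rw [Module.Basis.repr_symm_single, Module.Basis.tensorProduct_apply, map_smul, map_smul,
      TensorProduct.map_tmul, Finsupp.smul_apply, tensorCoeff_tmul, Submodule.subtype_apply,
      Submodule.subtype_apply, basisP_apply, basisP_apply, P_apply, P_apply,
      Finsupp.single_apply, ite_zero_mul_ite_zero, one_mul, smul_ite, smul_zero, smul_eq_mul,
      mul_one]
    simp only [Prod.mk.injEq, eq_comm (a := J₀), eq_comm (a := J₁)]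

/-- `Baxter.comul` is defined from coefficients at class representatives. By
`tensorCoeff_comul_P_congr` these are the coefficients at every pair of permutations in the same
classes. -/
theorem map_subtype_comul (x : Baxter K) :
    TensorProduct.map (Baxter K).subtype (Baxter K).subtype (Baxter.comul K x) =
      FQSym.comul K x := by
  suffices h : TensorProduct.map (Baxter K).subtype (Baxter K).subtype ∘ₗ Baxter.comul K =
      FQSym.comul K ∘ₗ (Baxter K).subtype from LinearMap.congr_fun h x
  refine (basisP K).ext fun J => (tensorCoeff K).injective ?_
  ext ⟨α, β⟩
  rw [LinearMap.comp_apply, LinearMap.comp_apply, Baxter.comul_basisP, tensorCoeff_map_subtype,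
    Submodule.subtype_apply, basisP_apply, comulCoeff, Finsupp.comapDomain_apply]
  exact tensorCoeff_comul_P_congr K J (twinPair_representative _) (twinPair_representative _)

theorem isBooleanCoalgebraBasis_basisP :
    IsBooleanCoalgebraBasis (Baxter.comul K) (basisP K) := by
  classical
  intro J J₀ J₁
  rw [Baxter.comul_basisP, LinearEquiv.apply_symm_apply, comulCoeff, Finsupp.comapDomain_apply,
    Prod.map_apply, tensorCoeff_comul_P]
  exact (ite_eq_or_eq _ _ _).symm

end Algebra

end BaxterHopf

theorem mainTheorem12 (K : Type*) [Field K] [CharZero K] :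
    ∃ (μ : BaxterHopf.Baxter K →ₗ[K] BaxterHopf.Baxter K →ₗ[K] BaxterHopf.Baxter K)
      (δ : BaxterHopf.Baxter K →ₗ[K] BaxterHopf.Baxter K ⊗[K] BaxterHopf.Baxter K)
      (b : Module.Basis BaxterHopf.TwinPair K (BaxterHopf.Baxter K)),
      -- the product of `Baxter` is the restriction of the one of `FQSym`
      (∀ x y, (μ x y : BaxterHopf.FQSym K) = BaxterHopf.FQSym.mul K x y) ∧
      -- the coproduct of `Baxter` is the restriction of the one of `FQSym`
      (∀ x, TensorProduct.map (BaxterHopf.Baxter K).subtype (BaxterHopf.Baxter K).subtype (δ x) =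
        BaxterHopf.FQSym.comul K x) ∧
      -- the basis is the family `P`
      (∀ J, (b J : BaxterHopf.FQSym K) = BaxterHopf.P K J) ∧
      BaxterHopf.IsBooleanAlgebraBasis μ b ∧
      BaxterHopf.IsBooleanCoalgebraBasis δ b :=
  ⟨BaxterHopf.Baxter.mul K, BaxterHopf.Baxter.comul K, BaxterHopf.basisP K, fun _ _ => rfl,
    BaxterHopf.map_subtype_comul K, BaxterHopf.basisP_apply K,
    BaxterHopf.isBooleanAlgebraBasis_basisP K, BaxterHopf.isBooleanCoalgebraBasis_basisP K⟩
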